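/- Let $X$ be a topological space (no separation axiom is assumed) with $|X|<\aleph_\omega$. A set $D\subseteq X$ is strongly discrete if its points can be separated by pairwise disjoint open neighbourhoods in $X$. A space is SD if each of its non-isolated points is an accumulation point of some strongly discrete set, and it is DSD if all of its dense subspaces are SD. The space $X$ is $\kappa$-resolvable if it contains $\kappa$ many pairwise disjoint dense subsets. It is maximally resolvable if it is $\Delta(X)$-resolvable, where $\Delta(X)=\min\{|G| : \emptyset\ne G\subseteq X \text{ open}\}$ (and $\Delta(\emptyset)=0$). The space $X$ is monotonically normal if it is $T_1$ and there is a function $H$ assigning to each pair $(x,U)$ with $U\subseteq X$ open and $x\in U$ an open set $H(x,U)$ such that (1) $x\in H(x,U)\subseteq U$, and (2) $H(x,U)\cap H(y,V)\neq\emptyset$ implies $x\in V$ or $y\in U$. (a) If $X$ is DSD, then $X$ is maximally resolvable. (b) In particular, if $X$ is monotonically normal, then $X$ is maximally resolvable. -/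

import Mathlib

open Set Topology Cardinal

universe u

/-- A space `X` is `κ`-resolvable if it contains `κ` many pairwise disjoint dense subsets. -/
def IsResolvable (X : Type u) [TopologicalSpace X] (κ : Cardinal.{u}) : Prop :=
  ∃ 𝒟 : Set (Set X), #𝒟 = κ ∧ (∀ D ∈ 𝒟, Dense D) ∧ 𝒟.Pairwise Disjoint

/-- The dispersion character `Δ(X)`: the least cardinality of a nonempty open subset of `X`
(with the value `0` for the empty space). -/
noncomputable def dispersionCharacter (X : Type u) [TopologicalSpace X] : Cardinal.{u} :=
  sInf {κ | ∃ G : Set X, IsOpen G ∧ G.Nonempty ∧ #G = κ}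

/-- A space `X` is maximally resolvable if it is `Δ(X)`-resolvable. -/
def IsMaximallyResolvable (X : Type u) [TopologicalSpace X] : Prop :=
  IsResolvable X (dispersionCharacter X)

/-- A set `D` is strongly discrete if its points can be separated by pairwise disjoint
(open) neighbourhoods. -/
def IsStronglyDiscrete {X : Type u} [TopologicalSpace X] (D : Set X) : Prop :=
  ∃ U : X → Set X, (∀ d ∈ D, IsOpen (U d) ∧ d ∈ U d) ∧ D.PairwiseDisjoint U

/-- A space is SD if every non-isolated point is an accumulation point of some strongly
discrete set. -/
def IsSDSpace (X : Type u) [TopologicalSpace X] : Prop :=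
  ∀ x : X, ¬ IsOpen ({x} : Set X) →
    ∃ D : Set X, IsStronglyDiscrete D ∧ AccPt x (Filter.principal D)

/-- A space is DSD if all of its dense subspaces are SD. -/
def IsDSDSpace (X : Type u) [TopologicalSpace X] : Prop :=
  ∀ Y : Set X, Dense Y → IsSDSpace Y

/-- The marked open sets of `X`: pairs `(x, U)` with `U` open and `x ∈ U`. -/
abbrev MarkedOpen (X : Type u) [TopologicalSpace X] : Type u :=
  {p : X × TopologicalSpace.Opens X // p.1 ∈ p.2}

/-- A space is monotonically normal if it is `T₁` and has a monotone normality operator. -/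
def IsMonotonicallyNormal (X : Type u) [TopologicalSpace X] : Prop :=
  T1Space X ∧ ∃ H : MarkedOpen X → TopologicalSpace.Opens X,
    (∀ p : MarkedOpen X, p.1.1 ∈ H p ∧ H p ≤ p.1.2) ∧
    ∀ p q : MarkedOpen X, ((H p : Set X) ∩ (H q : Set X)).Nonempty →
      p.1.1 ∈ q.1.2 ∨ q.1.1 ∈ p.1.2

/-!
The crux is local: every nonempty open set `G` must contain `κ` pairwise disjoint nonempty sets each
of which is dense in their union (`IsMutuallyDense`), where `κ` is the least cardinality of a
nonempty open subset of `G`. A Zorn argument (`exists_pairwise_disjoint_dense`) then produces dense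
sets. One may assume that all nonempty open subsets of `G` have size `κ`, and that `κ` is infinite;
since `|X| < ℵ_ω`, it is some `ℵ_ n`, hence regular. There are two cases.

* The points `x` that are accumulated by sets of size `< κ` even after any set of size `< κ` has
  been removed are dense in `G`. Choosing `κ` such small sets for each of these points, all of them
  disjoint, by transfinite recursion gives the family (`exists_isMutuallyDense_of_small`).
* Otherwise one passes to an open set in which every point `x` has a set `Y` with `|Y| < κ` such that
  any set avoiding `Y` and accumulating at `x` has size `κ`. The DSD property, applied to a dense
  subspace avoiding `Y`, gives a strongly discrete `D` accumulating at `x`, and the traces of the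
  neighbourhoods of `x` on `D` extend to a uniform ultrafilter on a set of size `ℵ_ n`. By a
  theorem of Kunen and Prikry such an ultrafilter is `ω_ i`-decomposable for all `i ≤ n`
  (`Ultrafilter.IsOmegaDecomposable.of_succ`), so that `D` carries labels in `ω_ i` that are
  unbounded near `x`. Iterating `x ↦ D` inside disjoint neighbourhoods grows a tree of height `ω`
  (`BranchingSystem`). A colour `ν < ω_ n` is reached below every node: a label `α > ν` in `ω_ n`
  reduces it to some `β < ω_ (n - 1)` by an enumeration of the ordinals below `α`, and so on down to
  a natural number. The finite list of the levels used and of this number is read off from the level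
  of the node to be coloured (`BranchingSystem.exists_isMutuallyDense`). Nodes at different levels
  are different points, as the cells of the successors of `x` are chosen to miss `x`; no separation
  axiom is needed for this.

A monotonically normal space is DSD because monotone normality is hereditary and a maximal disjoint
family of sets `H (y, W)` with `x ∉ W` has points `y` accumulating at `x`
(`IsMonotonicallyNormal.isSDSpace`).
-/

/-! ### Cardinal arithmetic below `ℵ_ω` -/

/-- The initial ordinal `ω_ n` for a natural number `n`, as a well-ordered type. -/
abbrev OmegaType (n : ℕ) : Type u := (ℵ_ (n : Ordinal.{u})).ord.ToType

theorem isRegular_aleph_natCast (n : ℕ) : (ℵ_ (n : Ordinal.{u})).IsRegular := by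
  cases n with
  | zero => simpa using isRegular_aleph0
  | succ n => simpa using isRegular_aleph_add_one (n : Ordinal.{u})

theorem mk_omegaType (n : ℕ) : #(OmegaType.{u} n) = ℵ_ (n : Ordinal.{u}) := mk_ord_toType _

theorem mk_Iio_omegaType_lt {n : ℕ} (a : OmegaType.{u} n) :
    #(Iio a) < ℵ_ (n : Ordinal.{u}) := by
  simpa using mk_Iio_lt a (by simp)

theorem mk_Iic_omegaType_lt {n : ℕ} (a : OmegaType.{u} n) :
    #(Iic a) < ℵ_ (n : Ordinal.{u}) := by
  rw [← Iio_insert]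
  exact mk_insert_le.trans_lt (add_lt_of_lt (aleph0_le_aleph _) (mk_Iio_omegaType_lt a)
    (one_lt_aleph0.trans_le (aleph0_le_aleph _)))

instance (n : ℕ) : NoMaxOrder (OmegaType.{u} n) := noMaxOrder (aleph0_le_aleph _)

instance (n : ℕ) : Nonempty (OmegaType.{u} n) := by
  rw [← mk_ne_zero_iff, mk_omegaType]
  exact (aleph_pos _).ne'

theorem exists_forall_le_of_mk_lt {n : ℕ} {s : Set (OmegaType.{u} n)}
    (hs : #s < ℵ_ (n : Ordinal.{u})) : ∃ b, ∀ a ∈ s, a ≤ b := by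
  by_contra! h
  have hU : (⋃ a ∈ s, Iic a) = Set.univ := eq_univ_of_forall fun b ↦ by
    obtain ⟨a, ha, hab⟩ := h b
    exact mem_biUnion ha hab.le
  have := (card_biUnion_lt_iff_forall_of_isRegular (isRegular_aleph_natCast n) hs
    (t := fun a _ ↦ Iic a)).2 fun a _ ↦ mk_Iic_omegaType_lt a
  rw [hU, mk_univ, mk_omegaType] at this
  exact this.false

/-- A choice, for every `α < ω_ (n + 1)`, of an injection of the ordinals below `α` into `ω_ n`. -/
theorem exists_injOn_Iio (n : ℕ) :
    ∃ e : OmegaType.{u} (n + 1) → OmegaType.{u} (n + 1) → OmegaType.{u} n,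
      ∀ α, InjOn (e α) (Iio α) := by
  have key (α : OmegaType.{u} (n + 1)) :
      ∃ f : OmegaType.{u} (n + 1) → OmegaType.{u} n, InjOn f (Iio α) := by
    have h : #(Iio α) ≤ #(OmegaType.{u} n) := by
      rw [mk_omegaType, ← Order.lt_succ_iff, succ_aleph, ← Nat.cast_add_one]
      exact mk_Iio_omegaType_lt α
    obtain ⟨f⟩ := h
    classical
    refine ⟨fun x ↦ if h : x ∈ Iio α then f ⟨x, h⟩ else Classical.arbitrary _, ?_⟩
    intro x hx y hy hxy
    simp only [hx, hy, dif_pos] at hxy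
    exact congrArg Subtype.val (f.injective hxy)
  choose e he using key
  exact ⟨e, he⟩

theorem exists_surjOn_Iio (n : ℕ) :
    ∃ e : OmegaType.{u} (n + 1) → OmegaType.{u} n → OmegaType.{u} (n + 1),
      ∀ α, ∀ ν < α, ∃ β, e α β = ν := by
  obtain ⟨e, he⟩ := exists_injOn_Iio.{u} n
  exact ⟨fun α ↦ Function.invFunOn (e α) (Iio α),
    fun α ν hν ↦ ⟨e α ν, (he α).leftInvOn_invFunOn hν⟩⟩

/-- Choosing sets one after the other along `ω_ n`: if a set of size `< ℵ_ n` with the required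
property can always be found outside a given set of size `< ℵ_ n`, then pairwise disjoint sets
with these properties can be found simultaneously. -/
theorem exists_pairwise_disjoint_of_forall_small {X : Type u} (n : ℕ)
    (P : OmegaType.{u} n → Set X → Prop)
    (h : ∀ a, ∀ Y : Set X, #Y < ℵ_ (n : Ordinal.{u}) →
      ∃ D : Set X, #D < ℵ_ (n : Ordinal.{u}) ∧ Disjoint D Y ∧ P a D) :
    ∃ D : OmegaType.{u} n → Set X, Pairwise (Function.onFun Disjoint D) ∧ ∀ a, P a (D a) := by
  choose! S hS using h
  let D : OmegaType.{u} n → Set X :=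
    WellFoundedLT.fix fun a D ↦ S a (⋃ b : Iio a, D b b.2)
  have hD (a) : D a = S a (⋃ b : Iio a, D b.1) := WellFoundedLT.fix_eq _ a
  have hsmall (a) : #(⋃ b : Iio a, D b.1) < ℵ_ (n : Ordinal.{u}) := by
    induction a using WellFoundedLT.induction with
    | ind a ih =>
      refine (card_iUnion_lt_iff_forall_of_isRegular (isRegular_aleph_natCast n)
        (mk_Iio_omegaType_lt a)).2 fun b ↦ ?_
      rw [hD]
      exact (hS b _ (ih b b.2)).1
  have hlt {a b} (hab : b < a) : Disjoint (D a) (D b) := by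
    rw [hD a]
    exact (hS a _ (hsmall a)).2.1.mono_right (subset_iUnion (fun b : Iio a ↦ D b) ⟨b, hab⟩)
  refine ⟨D, fun a b hab ↦ ?_, fun a ↦ ?_⟩
  · rcases hab.lt_or_gt with h | h
    exacts [(hlt h).symm, hlt h]
  · rw [hD a]
    exact (hS a _ (hsmall a)).2.2

/-! ### Decomposable ultrafilters -/

/-- An ultrafilter is `ω_ n`-decomposable if some function into `ω_ n` is unbounded modulo it. -/
def Ultrafilter.IsOmegaDecomposable {X : Type u} (F : Ultrafilter X) (n : ℕ) : Prop :=
  ∃ f : X → OmegaType.{u} n, ∀ ν, ∀ᶠ x in F, ν < f x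

/-- An `ω_ (n + 1)`-decomposable ultrafilter is `ω_ n`-decomposable. For `f` unbounded modulo the
ultrafilter, consider the functions `h ξ x = e (f x) ξ`, where `e α` injects the ordinals below `α`
into `ω_ n`. If none of them is unbounded, then `ω_ n` many of them share one bound `β`; the
injectivity of `e (f x)` then bounds the set of those indices `j` for which the `j`-th of these
functions is at most `β` at `x`, and this bound is a function of `x` unbounded modulo the
ultrafilter. -/
theorem Ultrafilter.IsOmegaDecomposable.of_succ {X : Type u} {F : Ultrafilter X} {n : ℕ}
    (hF : F.IsOmegaDecomposable (n + 1)) : F.IsOmegaDecomposable n := by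
  obtain ⟨f, hf⟩ := hF
  obtain ⟨e, he⟩ := exists_injOn_Iio.{u} n
  by_contra hn
  have hbdd (ξ : OmegaType.{u} (n + 1)) : ∃ β : OmegaType.{u} n, ∀ᶠ x in F, e (f x) ξ ≤ β := by
    by_contra! hβ
    exact hn ⟨fun x ↦ e (f x) ξ, fun ν ↦ hβ ν⟩
  choose b hb using hbdd
  obtain ⟨β, hβ⟩ := infinite_pigeonhole b (by rw [mk_omegaType]; exact aleph0_le_aleph _) (by
    rw [mk_omegaType, mk_omegaType, (isRegular_aleph_natCast (n + 1)).cof_ord]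
    simp)
  obtain ⟨j⟩ : #(OmegaType.{u} n) ≤ #(b ⁻¹' {β}) := by
    rw [hβ, mk_omegaType, mk_omegaType]
    simp
  have hsup (x : X) : ∃ s : OmegaType.{u} n,
      ∀ i ∈ {i | (j i : OmegaType.{u} (n + 1)) < f x ∧ e (f x) (j i) ≤ β}, i ≤ s := by
    refine exists_forall_le_of_mk_lt (lt_of_le_of_lt ?_ (mk_Iic_omegaType_lt β))
    refine mk_le_of_injective (f := fun i ↦ (⟨e (f x) (j i), i.2.2⟩ : Iic β)) ?_
    intro i i' hii
    have h1 := he (f x) i.2.1 i'.2.1 (congrArg Subtype.val hii)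
    exact Subtype.ext (j.injective (Subtype.ext h1))
  choose s hs using hsup
  refine hn ⟨s, fun ν ↦ ?_⟩
  obtain ⟨i, hi⟩ := exists_gt ν
  have hji : b (j i) = β := (j i).2
  filter_upwards [hf (j i), hb (j i)] with x hx hx'
  exact hi.trans_le (hs x i ⟨hx, hx'.trans_eq hji⟩)

theorem Ultrafilter.IsOmegaDecomposable.mono {X : Type u} {F : Ultrafilter X} {m n : ℕ}
    (hmn : m ≤ n) (hF : F.IsOmegaDecomposable n) : F.IsOmegaDecomposable m :=
  Nat.decreasingInduction (motive := fun k _ ↦ F.IsOmegaDecomposable k)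
    (fun _ _ h ↦ h.of_succ) hF hmn

/-- A uniform filter on a set of size `ℵ_ n` extends to an `ω_ n`-decomposable ultrafilter. -/
theorem exists_isOmegaDecomposable {X : Type u} {n : ℕ} {D : Set X}
    (hD : #D = ℵ_ (n : Ordinal.{u})) {l : Filter X}
    (hl : ∀ s ∈ l, ℵ_ (n : Ordinal.{u}) ≤ #(s ∩ D : Set X)) :
    ∃ F : Ultrafilter X, ↑F ≤ l ∧ D ∈ F ∧ F.IsOmegaDecomposable n := by
  have hne : (l ⊓ Filter.principal D ⊓
      Filter.cocardinal X (isRegular_aleph_natCast n)).NeBot := by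
    refine Filter.inf_neBot_iff.2 fun s hs t ht ↦ ?_
    rw [Filter.mem_cocardinal] at ht
    rw [Filter.mem_inf_principal] at hs
    by_contra hst
    refine (hl _ hs).not_gt ((mk_le_mk_of_subset ?_).trans_lt ht)
    exact fun x hx hxt ↦ hst ⟨x, hx.1 hx.2, hxt⟩
  let F := Ultrafilter.of (l ⊓ Filter.principal D ⊓
    Filter.cocardinal X (isRegular_aleph_natCast n))
  have hF : (F : Filter X) ≤ _ := Ultrafilter.of_le (l ⊓ Filter.principal D ⊓
    Filter.cocardinal X (isRegular_aleph_natCast n))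
  have hDF : D ∈ F := hF (Filter.mem_inf_of_left (Filter.mem_inf_of_right
    (Filter.mem_principal_self D)))
  refine ⟨F, hF.trans (inf_le_left.trans inf_le_left), hDF, ?_⟩
  obtain ⟨g⟩ : #D ≤ #(OmegaType.{u} n) := by rw [hD, mk_omegaType]
  classical
  let f : X → OmegaType.{u} n := fun x ↦ if h : x ∈ D then g ⟨x, h⟩ else Classical.arbitrary _
  refine ⟨f, fun ν ↦ ?_⟩
  have hsmall : {x | x ∈ D ∧ f x ≤ ν}ᶜ ∈ F := by
    refine hF (Filter.mem_inf_of_right (Filter.mem_cocardinal.2 ?_))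
    rw [compl_compl]
    refine lt_of_le_of_lt ?_ (mk_Iic_omegaType_lt ν)
    refine mk_le_of_injective (f := fun x ↦ (⟨f x, x.2.2⟩ : Iic ν)) ?_
    intro x y hxy
    have h1 : f x = f y := congrArg Subtype.val hxy
    simp only [f, x.2.1, y.2.1, dif_pos] at h1
    exact Subtype.ext (Subtype.mk.inj (g.injective h1))
  filter_upwards [hDF, hsmall] with x hx hx'
  exact lt_of_not_ge fun h ↦ hx' ⟨hx, h⟩

/-! ### Branching systems and their colourings -/

/-- A rule for growing a tree of marked open sets inside the open set `region`, starting from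
`root`. A marked open set `s = (x, V)` has the points of `children s ⊆ V` as successors; the
successor `d` comes with the marked open set `cell s d = (d, W)`, where the sets `W ⊆ V` are
pairwise disjoint and miss `x`. For each `i ≤ n` the successors carry labels in `ω_ i`, unbounded
on every neighbourhood of `x`. The rule is only constrained at marked open subsets of `region`. -/
structure BranchingSystem (X : Type u) [TopologicalSpace X] (n : ℕ) where
  /-- The open set in which the tree grows. -/
  region : TopologicalSpace.Opens X
  /-- The point from which the tree grows. -/
  root : X
  root_mem : root ∈ region
  /-- The successors of a node. -/
  children : MarkedOpen X → Set X
  /-- The marked open set belonging to a successor. -/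
  cell : MarkedOpen X → X → MarkedOpen X
  /-- The labels in `ω_ i` of the successors. -/
  label : MarkedOpen X → (i : ℕ) → X → OmegaType.{u} i
  cell_point : ∀ s, s.1.2 ≤ region → ∀ d ∈ children s, (cell s d).1.1 = d
  cell_le : ∀ s, s.1.2 ≤ region → ∀ d ∈ children s, (cell s d).1.2 ≤ s.1.2
  notMem_cell : ∀ s, s.1.2 ≤ region → ∀ d ∈ children s, s.1.1 ∉ (cell s d).1.2
  eq_of_mem_cell : ∀ s, s.1.2 ≤ region → ∀ d ∈ children s, ∀ d' ∈ children s, ∀ y,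
    y ∈ (cell s d).1.2 → y ∈ (cell s d').1.2 → d = d'
  exists_lt_label : ∀ s, s.1.2 ≤ region → ∀ O : Set X, IsOpen O → s.1.1 ∈ O →
    ∀ i ≤ n, ∀ ν, ∃ d ∈ children s, d ∈ O ∧ ν < label s i d

namespace BranchingSystem

variable {X : Type u} [TopologicalSpace X] {n : ℕ} (B : BranchingSystem X n)

/-- The marked open set at the root of the tree. -/
def rootCell : MarkedOpen X := ⟨(B.root, B.region), B.root_mem⟩

open Classical in
/-- The cells of the tree that contain the point `y`, level by level. The value is `none` from the
first level on at which no cell contains `y`. -/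
noncomputable def descent (y : X) : ℕ → Option (MarkedOpen X)
  | 0 => some B.rootCell
  | m + 1 => (descent y m).bind fun s ↦
      if h : ∃ d ∈ B.children s, y ∈ (B.cell s d).1.2 then some (B.cell s h.choose) else none

/-- The point `s.1.1` is a node of the tree at level `m`, with cell `s.1.2`. -/
def IsNode (m : ℕ) (s : MarkedOpen X) : Prop := B.descent s.1.1 m = some s

variable {B}

theorem descent_succ {y : X} {m : ℕ} {t : MarkedOpen X} (h : B.descent y (m + 1) = some t) :
    ∃ s, B.descent y m = some s ∧ ∃ d ∈ B.children s, y ∈ (B.cell s d).1.2 ∧ t = B.cell s d := by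
  rw [descent, Option.bind_eq_some_iff] at h
  obtain ⟨s, hs, h⟩ := h
  split_ifs at h with hd
  exact ⟨s, hs, hd.choose, hd.choose_spec.1, hd.choose_spec.2, (Option.some.inj h).symm⟩

theorem le_region_of_descent {y : X} {m : ℕ} {s : MarkedOpen X} (h : B.descent y m = some s) :
    s.1.2 ≤ B.region := by
  induction m generalizing s with
  | zero =>
    obtain rfl := Option.some.inj h
    exact le_rfl
  | succ m ih =>
    obtain ⟨t, ht, d, hd, -, rfl⟩ := descent_succ h
    exact (B.cell_le t (ih ht) d hd).trans (ih ht)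

theorem descent_succ_of_mem {y : X} {m : ℕ} {s : MarkedOpen X} (h : B.descent y m = some s)
    {d : X} (hd : d ∈ B.children s) (hy : y ∈ (B.cell s d).1.2) :
    B.descent y (m + 1) = some (B.cell s d) := by
  have hex : ∃ d ∈ B.children s, y ∈ (B.cell s d).1.2 := ⟨d, hd, hy⟩
  rw [descent, h, Option.bind_some, dif_pos hex,
    B.eq_of_mem_cell s (le_region_of_descent h) d hd _ hex.choose_spec.1 y hy hex.choose_spec.2]

theorem descent_eq_of_mem {y : X} {m : ℕ} {s : MarkedOpen X} (h : B.descent y m = some s)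
    {z : X} (hz : z ∈ s.1.2) : B.descent z m = some s := by
  induction m generalizing s with
  | zero => exact h
  | succ m ih =>
    obtain ⟨t, ht, d, hd, -, rfl⟩ := descent_succ h
    exact descent_succ_of_mem (ih ht (B.cell_le t (le_region_of_descent ht) d hd hz)) hd hz

variable (B) in
theorem isNode_rootCell : B.IsNode 0 B.rootCell := rfl

theorem IsNode.le_region {m : ℕ} {s : MarkedOpen X} (h : B.IsNode m s) : s.1.2 ≤ B.region :=
  le_region_of_descent h

theorem IsNode.cell {m : ℕ} {s : MarkedOpen X} (h : B.IsNode m s) {d : X}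
    (hd : d ∈ B.children s) : B.IsNode (m + 1) (B.cell s d) := by
  have hdm := (B.cell s d).2
  exact descent_succ_of_mem (descent_eq_of_mem h (B.cell_le s h.le_region d hd hdm)) hd hdm

/-- A node lies in no cell of a level beyond its own. -/
theorem IsNode.descent_eq_none {m : ℕ} {s : MarkedOpen X} (h : B.IsNode m s) {k : ℕ}
    (hk : m < k) : B.descent s.1.1 k = none := by
  induction k, hk using Nat.le_induction with
  | base =>
    rw [Option.eq_none_iff_forall_ne_some]
    intro t ht
    obtain ⟨s', hs', d, hd, hy, -⟩ := descent_succ ht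
    obtain rfl := Option.some.inj (hs'.symm.trans h)
    exact B.notMem_cell _ h.le_region d hd hy
  | succ k _ ih => rw [descent, ih, Option.bind_none]

theorem IsNode.level_unique {m k : ℕ} {s t : MarkedOpen X} (hs : B.IsNode m s)
    (ht : B.IsNode k t) (hst : s.1.1 = t.1.1) : m = k := by
  by_contra hne
  rcases lt_or_gt_of_ne hne with h | h
  · have h1 := hs.descent_eq_none h
    rw [hst, ht] at h1
    cases h1
  · have h1 := ht.descent_eq_none h
    rw [← hst, hs] at h1
    cases h1

theorem IsNode.exists_descendant {O : Set X} (hO : IsOpen O) {m : ℕ} {s : MarkedOpen X}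
    (hs : B.IsNode m s) (hsO : s.1.1 ∈ O) {k : ℕ} (hk : m ≤ k) :
    ∃ t, B.IsNode k t ∧ t.1.1 ∈ O ∧ t.1.2 ≤ s.1.2 := by
  induction k, hk using Nat.le_induction with
  | base => exact ⟨s, hs, hsO, le_rfl⟩
  | succ k _ ih =>
    obtain ⟨t, ht, htO, hts⟩ := ih
    obtain ⟨d, hd, hdO, -⟩ := B.exists_lt_label t ht.le_region O hO htO 0 (Nat.zero_le n)
      (Classical.arbitrary _)
    refine ⟨B.cell t d, ht.cell hd, ?_, (B.cell_le t ht.le_region d hd).trans hts⟩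
    rwa [B.cell_point t ht.le_region d hd]

variable (B) in
/-- The label in `ω_ i` of the node at level `k + 1` on the way to `y`, read as a successor of the
node at level `k`. It is a junk value if `y` is in no cell of level `k + 1`. -/
noncomputable def pathLabel (y : X) (i k : ℕ) : OmegaType.{u} i :=
  B.label ((B.descent y k).getD B.rootCell) i ((B.descent y (k + 1)).getD B.rootCell).1.1

theorem IsNode.pathLabel_eq {m : ℕ} {s : MarkedOpen X} (hs : B.IsNode m s) {d : X}
    (hd : d ∈ B.children s) {y : X} (hy : y ∈ (B.cell s d).1.2) (i : ℕ) :
    B.pathLabel y i m = B.label s i d := by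
  rw [pathLabel, descent_eq_of_mem (hs.cell hd) hy,
    descent_eq_of_mem hs (B.cell_le s hs.le_region d hd hy), Option.getD_some, Option.getD_some,
    B.cell_point s hs.le_region d hd]

/-- The value in `ω_ i` coded by a list `k_i, …, k_1, k_0` of natural numbers: here `e₀ k_0` is
the value in `ω_ 0`, and a value `β` in `ω_ j` yields the value `e j (α (j + 1) k_{j + 1}) β` in
`ω_ (j + 1)`. -/
noncomputable def decodeColour (e₀ : ℕ → OmegaType.{u} 0)
    (e : (i : ℕ) → OmegaType.{u} (i + 1) → OmegaType.{u} i → OmegaType.{u} (i + 1))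
    (α : (i : ℕ) → ℕ → OmegaType.{u} i) : (i : ℕ) → List ℕ → OmegaType.{u} i
  | 0, l => e₀ l.headI
  | i + 1, l => e i (α (i + 1) l.headI) (decodeColour e₀ e α i l.tail)

/-- Every value `ν` in `ω_ i` is coded, on all of some cell near a given node `s`, by one list: pass
to a successor of `s` with label above `ν`, so that `ν` is indexed by some `β` in `ω_ (i - 1)`, and
repeat with `β` from there. -/
theorem IsNode.exists_decodeColour_eq {e₀ : ℕ → OmegaType.{u} 0} (he₀ : Function.Surjective e₀)
    {e : (i : ℕ) → OmegaType.{u} (i + 1) → OmegaType.{u} i → OmegaType.{u} (i + 1)}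
    (he : ∀ i α, ∀ ν < α, ∃ β, e i α β = ν) {O : Set X} (hO : IsOpen O) {i : ℕ} (hi : i ≤ n)
    {m : ℕ} {s : MarkedOpen X} (hs : B.IsNode m s) (hsO : s.1.1 ∈ O) (ν : OmegaType.{u} i) :
    ∃ (l : List ℕ) (k : ℕ) (t : MarkedOpen X), B.IsNode k t ∧ t.1.1 ∈ O ∧ t.1.2 ≤ s.1.2 ∧
      ∀ y ∈ t.1.2, decodeColour e₀ e (B.pathLabel y) i l = ν := by
  induction i generalizing m s with
  | zero =>
    obtain ⟨k, rfl⟩ := he₀ ν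
    exact ⟨[k], m, s, hs, hsO, le_rfl, fun y _ ↦ rfl⟩
  | succ i ih =>
    obtain ⟨d, hd, hdO, hν⟩ := B.exists_lt_label s hs.le_region O hO hsO (i + 1) hi ν
    obtain ⟨β, hβ⟩ := he i _ ν hν
    have hdO' : (B.cell s d).1.1 ∈ O := by rwa [B.cell_point s hs.le_region d hd]
    obtain ⟨l, k, t, ht, htO, hts, hl⟩ := ih (Nat.le_of_succ_le hi) (hs.cell hd) hdO' β
    refine ⟨m :: l, k, t, ht, htO, hts.trans (B.cell_le s hs.le_region d hd), fun y hy ↦ ?_⟩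
    rw [decodeColour, List.headI_cons, List.tail_cons, hl y hy, hs.pathLabel_eq hd (hts hy), hβ]

end BranchingSystem

/-- Sets each of which is dense in the union of all of them, and which are pairwise disjoint. -/
structure IsMutuallyDense {X : Type u} [TopologicalSpace X] {ι : Type u} (E : ι → Set X) :
    Prop where
  pairwise_disjoint : Pairwise (Function.onFun Disjoint E)
  subset_closure : ∀ i j, E i ⊆ closure (E j)

/-- The nodes of a branching system carry a colouring with `ℵ_ n` colours such that near every node
all colours occur: the colour of a node at level `m` is decoded from the labels on the way to
it, by means of the `m`-th list in a sequence which repeats each list infinitely often. -/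
theorem BranchingSystem.exists_isMutuallyDense {X : Type u} [TopologicalSpace X] {n : ℕ}
    (B : BranchingSystem X n) :
    ∃ E : OmegaType.{u} n → Set X, IsMutuallyDense E ∧
      ∀ i, (E i).Nonempty ∧ E i ⊆ B.region := by
  obtain ⟨e₀, he₀⟩ : ∃ e₀ : ℕ → OmegaType.{u} 0, Function.Surjective e₀ := by
    have : Countable (OmegaType.{u} 0) := by
      rw [← mk_le_aleph0_iff, mk_omegaType]
      simp
    exact exists_surjective_nat _
  choose e he using exists_surjOn_Iio.{u}
  let code (m : ℕ) : List ℕ := Denumerable.ofNat (List ℕ) m.unpair.1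
  let E (ν : OmegaType.{u} n) : Set X := {y | ∃ m s, B.IsNode m s ∧ s.1.1 = y ∧
    decodeColour e₀ e (B.pathLabel y) n (code m) = ν}
  have key {m s} (hs : B.IsNode m s) {O : Set X} (hO : IsOpen O) (hsO : s.1.1 ∈ O) (ν) :
      (O ∩ E ν).Nonempty := by
    obtain ⟨l, k, t, ht, htO, -, hl⟩ := hs.exists_decodeColour_eq he₀ he hO le_rfl hsO ν
    -- A level beyond that of `t` whose list is `l`.
    obtain ⟨r, hr, hrO, hrt⟩ :=
      ht.exists_descendant hO htO (Nat.right_le_pair (Encodable.encode l) k)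
    refine ⟨r.1.1, hrO, _, r, hr, rfl, ?_⟩
    simp only [code, Nat.unpair_pair, Denumerable.ofNat_encode]
    exact hl _ (hrt r.2)
  refine ⟨E, ⟨fun ν ν' hne ↦ ?_, ?_⟩, fun ν ↦ ⟨?_, ?_⟩⟩
  · rw [Function.onFun, Set.disjoint_left]
    rintro y ⟨m, s, hs, rfl, hν⟩ ⟨m', s', hs', hss, hν'⟩
    obtain rfl := hs.level_unique hs' hss.symm
    exact hne (hν.symm.trans hν')
  · rintro ν ν' y ⟨m, s, hs, rfl, -⟩
    exact mem_closure_iff.2 fun O hO hsO ↦ key hs hO hsO ν'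
  · exact (key B.isNode_rootCell isOpen_univ (mem_univ _) ν).mono inter_subset_right
  · rintro y ⟨m, s, hs, rfl, -⟩
    exact hs.le_region s.2

/-- Branching systems arise from strongly discrete sets that accumulate at each point of an open set
along decomposable ultrafilters. -/
theorem exists_isMutuallyDense_of_decomposable {X : Type u} [TopologicalSpace X] {n : ℕ}
    {G : Set X} (hG : IsOpen G) (hne : G.Nonempty)
    (h : ∀ x ∈ G, ∃ D : Set X, IsStronglyDiscrete D ∧
      ∃ F : Ultrafilter X, ↑F ≤ 𝓝 x ∧ D ∈ F ∧ F.IsOmegaDecomposable n) :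
    ∃ E : OmegaType.{u} n → Set X, IsMutuallyDense E ∧ ∀ i, (E i).Nonempty ∧ E i ⊆ G := by
  have step (s : MarkedOpen X) (hs : (s.1.2 : Set X) ⊆ G) :
      ∃ (D : Set X) (c : X → MarkedOpen X) (f : (i : ℕ) → X → OmegaType.{u} i),
        (∀ d ∈ D, (c d).1.1 = d ∧ (c d).1.2 ≤ s.1.2 ∧ s.1.1 ∉ (c d).1.2) ∧
        (∀ d ∈ D, ∀ d' ∈ D, ∀ y, y ∈ (c d).1.2 → y ∈ (c d').1.2 → d = d') ∧
        ∀ O : Set X, IsOpen O → s.1.1 ∈ O → ∀ i ≤ n, ∀ ν, ∃ d ∈ D, d ∈ O ∧ ν < f i d := by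
    obtain ⟨⟨x, V⟩, hxV⟩ := s
    obtain ⟨D, ⟨U, hU, hdisj⟩, F, hF, hDF, hdec⟩ := h x (hs hxV)
    have hex (i : ℕ) : ∃ f : X → OmegaType.{u} i, i ≤ n → ∀ ν, ∀ᶠ x in F, ν < f x := by
      by_cases hi : i ≤ n
      · obtain ⟨f, hf⟩ := hdec.mono hi
        exact ⟨f, fun _ ↦ hf⟩
      · exact ⟨fun _ ↦ Classical.arbitrary _, fun h ↦ absurd h hi⟩
    choose f hf using hex
    have hVF : (V : Set X) ∈ F := hF (V.isOpen.mem_nhds hxV)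
    -- At most one of the disjoint neighbourhoods contains `x`, and `F` is not principal.
    have hxF : {d | d ∈ D ∧ x ∉ U d} ∈ F := by
      by_cases hx : ∃ d ∈ D, x ∈ U d
      · obtain ⟨d, hd, hxd⟩ := hx
        filter_upwards [hDF, hf 0 (Nat.zero_le n) (f 0 d)] with d' hd' hlt
        refine ⟨hd', fun hxd' ↦ ?_⟩
        obtain rfl := hdisj.elim_set hd hd' x hxd hxd'
        exact hlt.false
      · filter_upwards [hDF] with d hd
        exact ⟨hd, fun hxd ↦ hx ⟨d, hd, hxd⟩⟩
    classical
    let c (d : X) : MarkedOpen X := if hd : d ∈ D ∧ d ∈ V then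
      ⟨(d, ⟨U d, (hU d hd.1).1⟩ ⊓ V), (hU d hd.1).2, hd.2⟩ else ⟨(x, V), hxV⟩
    have hc {d} (hd : d ∈ D ∧ d ∈ V) : c d =
      ⟨(d, ⟨U d, (hU d hd.1).1⟩ ⊓ V), (hU d hd.1).2, hd.2⟩ := dif_pos hd
    refine ⟨{d | (d ∈ D ∧ d ∈ V) ∧ x ∉ U d}, c, f, ?_, ?_, ?_⟩
    · rintro d ⟨hd, hxd⟩
      rw [hc hd]
      exact ⟨rfl, inf_le_right, fun h ↦ hxd h.1⟩
    · rintro d ⟨hd, -⟩ d' ⟨hd', -⟩ y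
      rw [hc hd, hc hd']
      exact fun hy hy' ↦ hdisj.elim_set hd.1 hd'.1 y hy.1 hy'.1
    · intro O hO hxO i hi ν
      have : ∀ᶠ d in F, ((d ∈ D ∧ d ∈ V) ∧ x ∉ U d) ∧ d ∈ O ∧ ν < f i d := by
        filter_upwards [hxF, hVF, hF (hO.mem_nhds hxO), hf i hi ν] with d h1 h2 h3 h4
        exact ⟨⟨⟨h1.1, h2⟩, h1.2⟩, h3, h4⟩
      obtain ⟨d, hd, hd'⟩ := this.exists
      exact ⟨d, hd, hd'⟩
  choose! D c f h1 h2 h3 using step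
  obtain ⟨x, hx⟩ := hne
  exact BranchingSystem.exists_isMutuallyDense
    { region := ⟨G, hG⟩
      root := x
      root_mem := hx
      children := D
      cell := c
      label := f
      cell_point := fun s hs d hd ↦ (h1 s hs d hd).1
      cell_le := fun s hs d hd ↦ (h1 s hs d hd).2.1
      notMem_cell := fun s hs d hd ↦ (h1 s hs d hd).2.2
      eq_of_mem_cell := h2
      exists_lt_label := h3 }

/-! ### Strongly discrete sets in DSD spaces -/

/-- Strong discreteness passes from a dense subspace to the whole space: disjoint open subsets of
the subspace are traces of disjoint open sets. -/
theorem IsStronglyDiscrete.image_val {X : Type u} [TopologicalSpace X] {Z : Set X} (hZ : Dense Z)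
    {D : Set Z} (hD : IsStronglyDiscrete D) : IsStronglyDiscrete (Subtype.val '' D) := by
  obtain ⟨U, hU, hdisj⟩ := hD
  have hex (d : X) : ∃ O : Set X, ∀ h : d ∈ Z, ⟨d, h⟩ ∈ D →
      IsOpen O ∧ U ⟨d, h⟩ = Subtype.val ⁻¹' O := by
    by_cases h : ∃ h : d ∈ Z, ⟨d, h⟩ ∈ D
    · obtain ⟨h, hd⟩ := h
      obtain ⟨O, hO, hOU⟩ := isOpen_induced_iff.1 (hU _ hd).1
      exact ⟨O, fun _ _ ↦ ⟨hO, hOU.symm⟩⟩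
    · exact ⟨∅, fun h1 h2 ↦ absurd ⟨h1, h2⟩ h⟩
  choose O hO using hex
  refine ⟨O, ?_, ?_⟩
  · rintro _ ⟨d, hd, rfl⟩
    obtain ⟨h1, h2⟩ := hO d d.2 hd
    refine ⟨h1, ?_⟩
    have h3 := (hU d hd).2
    rwa [h2] at h3
  · rintro _ ⟨d, hd, rfl⟩ _ ⟨d', hd', rfl⟩ hne
    obtain ⟨h1, h2⟩ := hO d d.2 hd
    obtain ⟨h1', h2'⟩ := hO d' d'.2 hd'
    rw [Function.onFun, Set.disjoint_iff_inter_eq_empty, ← Set.not_nonempty_iff_eq_empty]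
    intro h
    obtain ⟨z, ⟨hz, hz'⟩, hzZ⟩ := hZ.inter_open_nonempty _ (h1.inter h1') h
    have hdd : Disjoint (U d) (U d') := hdisj hd hd' fun h ↦ hne (congrArg _ h)
    rw [h2, h2'] at hdd
    exact Set.disjoint_left.1 hdd (show (⟨z, hzZ⟩ : Z) ∈ _ from hz) hz'

theorem IsStronglyDiscrete.mono {X : Type u} [TopologicalSpace X] {C D : Set X}
    (hD : IsStronglyDiscrete D) (hCD : C ⊆ D) : IsStronglyDiscrete C := by
  obtain ⟨U, hU, hdisj⟩ := hD
  exact ⟨U, fun d hd ↦ hU d (hCD hd), hdisj.subset hCD⟩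

/-- Where all nonempty open sets are large, a small set `Y` can be avoided: the dense subspace
obtained by removing `Y`, except for the point `x`, is an SD space in which `x` is not isolated. -/
theorem IsDSDSpace.exists_isStronglyDiscrete {X : Type u} [TopologicalSpace X]
    (hX : IsDSDSpace X) {κ : Cardinal.{u}} (hκ : ℵ₀ ≤ κ) {G : Set X} (hG : IsOpen G)
    (hGκ : ∀ O ⊆ G, IsOpen O → O.Nonempty → κ ≤ #O) {Y : Set X} (hY : #Y < κ) {x : X}
    (hx : x ∈ G) : ∃ D ⊆ G \ Y, IsStronglyDiscrete D ∧ x ∈ closure D := by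
  have hYx : #(insert x Y : Set X) < κ :=
    mk_insert_le.trans_lt (add_lt_of_lt hκ hY (one_lt_aleph0.trans_le hκ))
  have hmeets {O : Set X} (hO : IsOpen O) (hOG : (O ∩ G).Nonempty) :
      ∃ z ∈ O ∩ G, z ∉ insert x Y := by
    by_contra! h
    exact ((hGκ _ inter_subset_right (hO.inter hG) hOG).trans
      (mk_le_mk_of_subset h)).not_gt hYx
  let Z : Set X := insert x (Y ∩ G)ᶜ
  have hZ : Dense Z := by
    refine dense_iff_inter_open.2 fun O hO hOne ↦ ?_
    by_cases hOG : (O ∩ G).Nonempty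
    · obtain ⟨z, hz, hzY⟩ := hmeets hO hOG
      exact ⟨z, hz.1, Or.inr fun h ↦ hzY (Or.inr h.1)⟩
    · obtain ⟨z, hz⟩ := hOne
      exact ⟨z, hz, Or.inr fun h ↦ hOG ⟨z, hz, h.2⟩⟩
  have hiso : ¬ IsOpen ({⟨x, Or.inl rfl⟩} : Set Z) := by
    intro h
    obtain ⟨O, hO, hOx⟩ := isOpen_induced_iff.1 h
    have hxO : (⟨x, Or.inl rfl⟩ : Z) ∈ Subtype.val ⁻¹' O := by rw [hOx]; rfl
    obtain ⟨z, hz, hzY⟩ := hmeets hO ⟨x, hxO, hx⟩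
    have hzZ : z ∈ Z := Or.inr fun h ↦ hzY (Or.inr h.1)
    have : (⟨z, hzZ⟩ : Z) ∈ Subtype.val ⁻¹' O := hz.1
    rw [hOx] at this
    exact hzY (Or.inl (congrArg Subtype.val this))
  obtain ⟨D, hD, hacc⟩ := hX Z hZ _ hiso
  refine ⟨(Subtype.val '' D ∩ G) \ {x}, ?_, (hD.image_val hZ).mono fun d hd ↦ hd.1.1, ?_⟩
  · rintro _ ⟨⟨⟨d, hd, rfl⟩, hdG⟩, hdx⟩
    refine ⟨hdG, fun hdY ↦ ?_⟩
    rcases d.2 with h | h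
    exacts [hdx h, h ⟨hdY, hdG⟩]
  · refine mem_closure_iff.2 fun O hO hxO ↦ ?_
    obtain ⟨d, ⟨hd, hdD⟩, hdx⟩ := accPt_iff_nhds.1 hacc (Subtype.val ⁻¹' (O ∩ G))
      (((hO.inter hG).preimage continuous_subtype_val).mem_nhds ⟨hxO, hx⟩)
    exact ⟨d, hd.1, ⟨⟨d, hdD, rfl⟩, hd.2⟩, fun h ↦ hdx (Subtype.ext h)⟩

/-! ### Constructing mutually dense families -/

/-- If the points at which small sets accumulate even after the removal of any small set are dense
in `G`, then the small sets can be chosen disjointly, `ℵ_ n` of them for each of these points. -/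
theorem exists_isMutuallyDense_of_small {X : Type u} [TopologicalSpace X] {n : ℕ} {G S : Set X}
    (hG : IsOpen G) (hne : G.Nonempty) (hGn : #G ≤ ℵ_ (n : Ordinal.{u}))
    (hS : ∀ x ∈ S, ∀ Y : Set X, #Y < ℵ_ (n : Ordinal.{u}) →
      ∃ D : Set X, Disjoint D Y ∧ #D < ℵ_ (n : Ordinal.{u}) ∧ x ∈ closure D)
    (hGS : G ⊆ closure S) :
    ∃ E : OmegaType.{u} n → Set X, IsMutuallyDense E ∧ ∀ i, (E i).Nonempty ∧ E i ⊆ G := by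
  have hdense : G ⊆ closure (S ∩ G) := fun x hx ↦ mem_closure_iff.2 fun O hO hxO ↦ by
    obtain ⟨z, hz, hzS⟩ := mem_closure_iff.1 (hGS hx) (O ∩ G) (hO.inter hG) ⟨hxO, hx⟩
    exact ⟨z, hz.1, hzS, hz.2⟩
  have hSne : Nonempty (S ∩ G : Set X) := by
    obtain ⟨x, hx⟩ := hne
    obtain ⟨z, -, hz⟩ := mem_closure_iff.1 (hdense hx) _ isOpen_univ (mem_univ x)
    exact ⟨⟨z, hz⟩⟩
  -- The recursion runs through all pairs of a point to be approached and a colour.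
  obtain ⟨q, hq⟩ : ∃ q : OmegaType.{u} n → (S ∩ G : Set X) × OmegaType.{u} n,
      Function.Surjective q := by
    have hle : #((S ∩ G : Set X) × OmegaType.{u} n) ≤ #(OmegaType.{u} n) := by
      rw [← mul_def, mk_omegaType]
      exact mul_le_of_le (aleph0_le_aleph _)
        ((mk_le_mk_of_subset inter_subset_right).trans hGn) le_rfl
    obtain ⟨j⟩ := hle
    exact ⟨_, Function.invFun_surjective j.injective⟩
  obtain ⟨D, hdisj, hD⟩ := exists_pairwise_disjoint_of_forall_small n
    (fun a D ↦ D ⊆ G ∧ ((q a).1 : X) ∈ closure D) (by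
      intro a Y hY
      obtain ⟨D, hDY, hDn, hxD⟩ := hS _ (q a).1.2.1 Y hY
      refine ⟨G ∩ D, (mk_le_mk_of_subset inter_subset_right).trans_lt hDn,
        hDY.mono_left inter_subset_right, inter_subset_left, ?_⟩
      exact hG.inter_closure ⟨(q a).1.2.2, hxD⟩)
  have hmem (x : X) (hx : x ∈ S ∩ G) (α) : x ∈ closure (⋃ a ∈ {a | (q a).2 = α}, D a) := by
    obtain ⟨a, ha⟩ := hq (⟨x, hx⟩, α)
    have h := (hD a).2
    rw [ha] at h
    exact closure_mono (subset_biUnion_of_mem (u := D) (show a ∈ {a | (q a).2 = α} by simp [ha])) h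
  have hsub (α) : ⋃ a ∈ {a | (q a).2 = α}, D a ⊆ G := iUnion₂_subset fun a _ ↦ (hD a).1
  refine ⟨fun α ↦ ⋃ a ∈ {a | (q a).2 = α}, D a, ⟨?_, ?_⟩, fun α ↦ ⟨?_, hsub α⟩⟩
  · intro α α' hne
    rw [Function.onFun, Set.disjoint_left]
    intro z hz hz'
    simp only [mem_iUnion, mem_ofPred_eq, exists_prop] at hz hz'
    obtain ⟨a, rfl, hza⟩ := hz
    obtain ⟨a', rfl, hza'⟩ := hz'
    exact Set.disjoint_left.1 (hdisj fun h ↦ hne (by rw [h])) hza hza'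
  · intro α α'
    exact (hsub α).trans (hdense.trans (closure_minimal (fun x hx ↦ hmem x hx α') isClosed_closure))
  · obtain ⟨x, hx⟩ := hSne
    exact closure_nonempty_iff.1 ⟨x, hmem x hx α⟩

/-- At a point `x` where small sets do not accumulate once a suitable small set `Y` is removed,
every strongly discrete set that avoids `Y` and accumulates at `x` is met by each neighbourhood of
`x` in `ℵ_ n` points, so that branching systems apply. -/
theorem IsDSDSpace.exists_isMutuallyDense {X : Type u} [TopologicalSpace X] (hX : IsDSDSpace X)
    {n : ℕ} {G : Set X} (hG : IsOpen G) (hne : G.Nonempty)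
    (hGn : ∀ O ⊆ G, IsOpen O → O.Nonempty → #O = ℵ_ (n : Ordinal.{u})) :
    ∃ E : OmegaType.{u} n → Set X, IsMutuallyDense E ∧ ∀ i, (E i).Nonempty ∧ E i ⊆ G := by
  let S : Set X := {x | ∀ Y : Set X, #Y < ℵ_ (n : Ordinal.{u}) →
      ∃ D : Set X, Disjoint D Y ∧ #D < ℵ_ (n : Ordinal.{u}) ∧ x ∈ closure D}
  have hGcard := hGn G subset_rfl hG hne
  by_cases hGS : G ⊆ closure S
  · exact exists_isMutuallyDense_of_small hG hne hGcard.le (fun x hx ↦ hx) hGS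
  obtain ⟨E, hE, hE'⟩ := exists_isMutuallyDense_of_decomposable (n := n)
    (hG.sdiff isClosed_closure) (sdiff_nonempty.2 hGS) (by
      rintro x ⟨hxG, hxS⟩
      have hxS' : x ∉ S := fun h ↦ hxS (subset_closure h)
      simp only [S, mem_ofPred_eq, not_forall] at hxS'
      obtain ⟨Y, hY, hxY⟩ := hxS'
      push Not at hxY
      obtain ⟨D, hDG, hD, hxD⟩ := hX.exists_isStronglyDiscrete (aleph0_le_aleph _) hG
        (fun O hOG hO hOne ↦ (hGn O hOG hO hOne).ge) hY hxG
      have hDY : Disjoint D Y := Set.disjoint_left.2 fun d hd ↦ (hDG hd).2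
      have hlarge : ∀ s ∈ 𝓝 x, ℵ_ (n : Ordinal.{u}) ≤ #(s ∩ D : Set X) := by
        intro s hs
        by_contra! hlt
        refine hxY _ (hDY.mono_left inter_subset_right) hlt (mem_closure_iff_nhds.2 fun t ht ↦ ?_)
        obtain ⟨z, hz, hzD⟩ := mem_closure_iff_nhds.1 hxD _ (Filter.inter_mem ht hs)
        exact ⟨z, hz.1, hz.2, hzD⟩
      have hDcard : #D = ℵ_ (n : Ordinal.{u}) := by
        refine le_antisymm ?_ ?_
        · exact (mk_le_mk_of_subset fun d hd ↦ (hDG hd).1).trans hGcard.le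
        · simpa using hlarge Set.univ Filter.univ_mem
      exact ⟨D, hD, exists_isOmegaDecomposable hDcard hlarge⟩)
  exact ⟨E, hE, fun i ↦ ⟨(hE' i).1, (hE' i).2.trans sdiff_subset⟩⟩

/-! ### From local to global resolvability -/

/-- A maximal mutually dense family is dense in the whole space. -/
theorem exists_pairwise_disjoint_dense {X : Type u} [TopologicalSpace X] {ι : Type u}
    (h : ∀ G : Set X, IsOpen G → G.Nonempty →
      ∃ E : ι → Set X, IsMutuallyDense E ∧ ∀ i, (E i).Nonempty ∧ E i ⊆ G) :
    ∃ E : ι → Set X, Pairwise (Function.onFun Disjoint E) ∧ ∀ i, Dense (E i) := by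
  obtain ⟨E, hE⟩ := zorn_le₀ {E : ι → Set X | IsMutuallyDense E} (by
    intro c hc hchain
    have hmem {i z} : z ∈ (sSup c) i ↔ ∃ E ∈ c, z ∈ E i := by
      simp [sSup_apply, iSup_eq_iUnion]
    refine ⟨sSup c, ⟨fun i j hij ↦ Set.disjoint_left.2 fun z hi hj ↦ ?_, fun i j z hi ↦ ?_⟩,
      fun E hE ↦ le_sSup hE⟩
    · obtain ⟨E, hE, hzE⟩ := hmem.1 hi
      obtain ⟨F, hF, hzF⟩ := hmem.1 hj
      rcases hchain.total hE hF with hle | hle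
      · exact Set.disjoint_left.1 ((hc hF).pairwise_disjoint hij) (hle i hzE) hzF
      · exact Set.disjoint_left.1 ((hc hE).pairwise_disjoint hij) hzE (hle j hzF)
    · obtain ⟨E, hE, hzE⟩ := hmem.1 hi
      exact closure_mono (fun y hy ↦ hmem.2 ⟨E, hE, hy⟩) ((hc hE).subset_closure i j hzE))
  refine ⟨E, hE.prop.pairwise_disjoint, fun j ↦ ?_⟩
  by_contra hj
  obtain ⟨F, hF, hF'⟩ := h (closure (E j))ᶜ isClosed_closure.isOpen_compl
    (nonempty_compl.2 fun h ↦ hj (dense_iff_closure_eq.2 h))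
  have hEF (i k) : Disjoint (E i) (F k) := Set.disjoint_left.2 fun z hz hz' ↦
    (hF' k).2 hz' (hE.prop.subset_closure i j hz)
  have hsup : IsMutuallyDense (E ⊔ F) := by
    refine ⟨fun i k hik ↦ ?_, fun i k ↦ ?_⟩
    · exact Disjoint.sup_left
        (Disjoint.sup_right (hE.prop.pairwise_disjoint hik) (hEF i k))
        (Disjoint.sup_right (hEF k i).symm (hF.pairwise_disjoint hik))
    · exact union_subset
        ((hE.prop.subset_closure i k).trans (closure_mono subset_union_left))
        ((hF.subset_closure i k).trans (closure_mono subset_union_right))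
  obtain ⟨z, hz⟩ := (hF' j).1
  exact (hF' j).2 hz (subset_closure (hE.le_of_ge hsup le_sup_left j (Or.inr hz)))

theorem IsResolvable.of_dense_family {X : Type u} [TopologicalSpace X] [Nonempty X] {ι : Type u}
    {E : ι → Set X} (hdisj : Pairwise (Function.onFun Disjoint E)) (hE : ∀ i, Dense (E i)) :
    IsResolvable X #ι := by
  refine ⟨range E, mk_range_eq _ fun i j hij ↦ ?_, forall_mem_range.2 hE, ?_⟩
  · by_contra hne
    have h := hdisj hne
    rw [Function.onFun, hij, disjoint_self] at h
    exact (hE j).nonempty.ne_empty h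
  · rintro _ ⟨i, rfl⟩ _ ⟨j, rfl⟩ hne
    exact hdisj fun h ↦ hne (by rw [h])

/-- An open set of least cardinality among the nonempty open subsets of a given one falls under
`IsDSDSpace.exists_isMutuallyDense` if it is infinite; if it is finite, it is indiscrete and its
singletons are mutually dense. -/
theorem IsDSDSpace.isMaximallyResolvable {X : Type u} [TopologicalSpace X] (hX : IsDSDSpace X)
    (hcard : #X < ℵ_ Ordinal.omega0) : IsMaximallyResolvable X := by
  rcases isEmpty_or_nonempty X with hempty | hne
  · refine ⟨∅, ?_, by simp, by simp⟩
    rw [mk_eq_zero, dispersionCharacter, eq_comm]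
    convert Cardinal.sInf_empty
    rw [eq_empty_iff_forall_notMem]
    rintro κ ⟨G, -, ⟨x, -⟩, -⟩
    exact isEmptyElim x
  suffices h : ∀ G : Set X, IsOpen G → G.Nonempty → ∃ E : (dispersionCharacter X).out → Set X,
      IsMutuallyDense E ∧ ∀ i, (E i).Nonempty ∧ E i ⊆ G by
    obtain ⟨E, hdisj, hE⟩ := exists_pairwise_disjoint_dense h
    rw [IsMaximallyResolvable, ← mk_out (dispersionCharacter X)]
    exact IsResolvable.of_dense_family hdisj hE
  intro G hG hGne
  obtain ⟨O, ⟨hOG, hO, hOne⟩, hmin⟩ : ∃ O ∈ {O : Set X | O ⊆ G ∧ IsOpen O ∧ O.Nonempty},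
      ∀ O' ∈ {O : Set X | O ⊆ G ∧ IsOpen O ∧ O.Nonempty}, #O ≤ #O' := by
    obtain ⟨O, hO, hmin⟩ := (InvImage.wf (fun O : Set X ↦ #O) Cardinal.lt_wf).has_min
      {O : Set X | O ⊆ G ∧ IsOpen O ∧ O.Nonempty} ⟨G, subset_rfl, hG, hGne⟩
    exact ⟨O, hO, fun O' hO' ↦ not_lt.1 (hmin O' hO')⟩
  have hΔ : #(dispersionCharacter X).out ≤ #O := by
    rw [mk_out]
    exact csInf_le' ⟨O, hO, hOne, rfl⟩
  suffices h : ∃ (κ : Type u) (E : κ → Set X), #O ≤ #κ ∧ IsMutuallyDense E ∧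
      ∀ i, (E i).Nonempty ∧ E i ⊆ O by
    obtain ⟨κ, E, hκ, hE, hE'⟩ := h
    obtain ⟨j⟩ := hΔ.trans hκ
    exact ⟨E ∘ j, ⟨fun a b hab ↦ hE.pairwise_disjoint (j.injective.ne hab),
      fun a b ↦ hE.subset_closure _ _⟩, fun i ↦ ⟨(hE' _).1, (hE' _).2.trans hOG⟩⟩
  rcases lt_or_ge #O ℵ₀ with hfin | hinf
  · refine ⟨O, fun x ↦ {x.1}, le_rfl, ⟨fun x y hxy ↦ ?_, fun x y ↦ ?_⟩,
      fun x ↦ ⟨singleton_nonempty _, singleton_subset_iff.2 x.2⟩⟩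
    · exact disjoint_singleton.2 fun h ↦ hxy (Subtype.ext h)
    · rw [singleton_subset_iff, mem_closure_iff]
      intro V hV hxV
      have hfinite : O.Finite := lt_aleph0_iff_set_finite.1 hfin
      -- A nonempty open subset of the finite set `O` has at least as many points as `O`.
      have hsub : V ∩ O = O := by
        refine hfinite.eq_of_subset_of_encard_le' inter_subset_right ?_
        exact OrderHomClass.mono Cardinal.toENat
          (hmin _ ⟨inter_subset_right.trans hOG, hV.inter hO, x, hxV, x.2⟩)
      exact ⟨y, (hsub.ge y.2).1, rfl⟩
  · obtain ⟨o, ho⟩ := mem_range_aleph_iff.2 hinf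
    obtain ⟨n, rfl⟩ : ∃ n : ℕ, o = n := by
      refine Ordinal.lt_omega0.1 (aleph_lt_aleph.1 ?_)
      rw [ho]
      exact (mk_set_le O).trans_lt hcard
    obtain ⟨E, hE, hE'⟩ := hX.exists_isMutuallyDense hO hOne (n := n) (by
      intro V hVO hV hVne
      rw [ho]
      exact (mk_le_mk_of_subset hVO).antisymm (hmin V ⟨hVO.trans hOG, hV, hVne⟩))
    exact ⟨_, E, by rw [mk_omegaType, ho], hE, hE'⟩

/-! ### Monotonically normal spaces -/

theorem IsMonotonicallyNormal.subtype {X : Type u} [TopologicalSpace X]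
    (hX : IsMonotonicallyNormal X) (Y : Set X) : IsMonotonicallyNormal Y := by
  obtain ⟨hT, H, hH, hHH⟩ := hX
  have hext (V : TopologicalSpace.Opens Y) : ∃ O : TopologicalSpace.Opens X,
      ∀ y : Y, (y : X) ∈ O ↔ y ∈ V := by
    obtain ⟨O, hO, hOV⟩ := isOpen_induced_iff.1 V.isOpen
    exact ⟨⟨O, hO⟩, fun y ↦ Set.ext_iff.1 hOV y⟩
  choose ext hext using hext
  let q (p : MarkedOpen Y) : MarkedOpen X := ⟨(p.1.1, ext p.1.2), (hext _ _).2 p.2⟩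
  refine ⟨inferInstance, fun p ↦ (H (q p)).comap ⟨Subtype.val, continuous_subtype_val⟩,
    fun p ↦ ⟨(hH (q p)).1, fun y hy ↦ (hext _ y).1 ((hH (q p)).2 hy)⟩, ?_⟩
  rintro p p' ⟨y, hy, hy'⟩
  exact (hHH (q p) (q p') ⟨y, hy, hy'⟩).imp (hext _ _).1 (hext _ _).1

/-- For a non-isolated point `x`, consider a maximal disjoint family of sets `H (y, W)` with
`x ∉ W`. Its points `y` form a strongly discrete set. If this set missed a neighbourhood `U` of `x`,
then `H (x, U)` would be disjoint from the whole family, which could be enlarged inside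
`H (x, U) \ {x}`. -/
theorem IsMonotonicallyNormal.isSDSpace {X : Type u} [TopologicalSpace X]
    (hX : IsMonotonicallyNormal X) : IsSDSpace X := by
  obtain ⟨hT, H, hH, hHH⟩ := hX
  intro x hx
  obtain ⟨A, hA⟩ := zorn_subset {A : Set (MarkedOpen X) | (∀ p ∈ A, x ∉ p.1.2) ∧
      A.PairwiseDisjoint fun p ↦ (H p : Set X)} (by
    intro c hc hchain
    refine ⟨⋃₀ c, ⟨?_, (pairwiseDisjoint_sUnion hchain.directedOn).2 fun A hA ↦ (hc hA).2⟩,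
      fun A hA ↦ subset_sUnion_of_mem hA⟩
    rintro p ⟨A, hA, hp⟩
    exact (hc hA).1 p hp)
  have hex (d : X) : ∃ U : Set X, ∀ p ∈ A, p.1.1 = d → U = H p := by
    by_cases hd : ∃ p ∈ A, p.1.1 = d
    · obtain ⟨p, hp, rfl⟩ := hd
      refine ⟨H p, fun p' hp' hpp ↦ ?_⟩
      rw [hA.prop.2.elim_set hp hp' p.1.1 (hH p).1 (hpp ▸ (hH p').1)]
    · exact ⟨∅, fun p hp hpd ↦ absurd ⟨p, hp, hpd⟩ hd⟩
  choose U hU using hex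
  refine ⟨(fun p ↦ p.1.1) '' A, ⟨U, ?_, ?_⟩, accPt_iff_nhds.2 fun V hV ↦ ?_⟩
  · rintro _ ⟨p, hp, rfl⟩
    rw [hU _ p hp rfl]
    exact ⟨(H p).isOpen, (hH p).1⟩
  · rintro _ ⟨p, hp, rfl⟩ _ ⟨p', hp', rfl⟩ hne
    rw [Function.onFun, hU _ p hp rfl, hU _ p' hp' rfl]
    exact hA.prop.2 hp hp' fun h ↦ hne (by rw [h])
  · by_contra! hVA
    obtain ⟨O, hOV, hO, hxO⟩ := mem_nhds_iff.1 hV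
    have hmiss : ∀ p ∈ A, p.1.1 ∉ O := fun p hp hpO ↦
      hA.prop.1 p hp (hVA p.1.1 ⟨hOV hpO, p, hp, rfl⟩ ▸ p.2)
    let px : MarkedOpen X := ⟨(x, ⟨O, hO⟩), hxO⟩
    have hdisj : ∀ p ∈ A, Disjoint (H px : Set X) (H p) := by
      intro p hp
      rw [Set.disjoint_iff_inter_eq_empty, ← Set.not_nonempty_iff_eq_empty]
      intro h
      rcases hHH px p h with h | h
      exacts [hA.prop.1 p hp h, hmiss p hp h]
    obtain ⟨z, hzH, hzx⟩ : ∃ z ∈ H px, z ≠ x := by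
      by_contra! h
      have : (H px : Set X) = {x} := Set.Subset.antisymm h (singleton_subset_iff.2 (hH px).1)
      exact hx (this ▸ (H px).isOpen)
    let pz : MarkedOpen X :=
      ⟨(z, ⟨(H px : Set X) \ {x}, (H px).isOpen.sdiff isClosed_singleton⟩), hzH, hzx⟩
    have hzA : pz ∈ A := by
      refine hA.le_of_ge (y := insert pz A) ⟨?_, ?_⟩ (subset_insert _ _) (mem_insert _ _)
      · rintro p (rfl | hp)
        exacts [fun h ↦ h.2 rfl, hA.prop.1 p hp]
      · refine hA.prop.2.insert fun p hp _ ↦ (hdisj p hp).mono_left ?_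
        exact fun y hy ↦ ((hH pz).2 hy).1
    exact hmiss pz hzA ((hH px).2 hzH)

theorem IsMonotonicallyNormal.isDSDSpace {X : Type u} [TopologicalSpace X]
    (hX : IsMonotonicallyNormal X) : IsDSDSpace X :=
  fun Y _ ↦ (hX.subtype Y).isSDSpace

theorem mainTheorem3 :
    (∀ (X : Type u) [TopologicalSpace X],
      IsDSDSpace X → #X < ℵ_ Ordinal.omega0 → IsMaximallyResolvable X) ∧
    (∀ (X : Type u) [TopologicalSpace X],
      IsMonotonicallyNormal X → #X < ℵ_ Ordinal.omega0 → IsMaximallyResolvable X) :=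
  ⟨fun _ _ hX hcard ↦ hX.isMaximallyResolvable hcard,
    fun _ _ hX hcard ↦ hX.isDSDSpace.isMaximallyResolvable hcard⟩
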